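/- Let $m,n,\ell\ge 0$ be integers, and let $\mathscr P(t,x)\subseteq\mathbb C[t,x]$ be a set of polynomials in the variables $x=(x_1,\dots,x_n)$ and the parameters $t=(t_1,\dots,t_m)$. For $a\in\mathbb C^m$ let $\mathscr P(a,x)\subseteq\mathbb C[x]$ be the system obtained by substituting $t=a$. The number of its solutions in $\mathbb C^n$ counted with multiplicity is $\sum_p \dim_{\mathbb C}\mathcal O_p/\mathscr P(a,x)\mathcal O_p\in\{0,1,2,\dots,\infty\}$, the sum being over all common zeros $p\in\mathbb C^n$ of $\mathscr P(a,x)$, where $\mathcal O_p$ is the local ring of $\mathbb C^n$ at $p$. Let $\succ_x$ and $\succ_t$ be arbitrary monomial orders on $\mathbb C[x]$ and $\mathbb C[t]$, and let $\succ$ be the block order on $\mathbb C[t,x]$ with $t^{d_1}x^{e_1}\succ t^{d_2}x^{e_2}$ if and only if $x^{e_1}\succ_x x^{e_2}$, or $x^{e_1}=x^{e_2}$ and $t^{d_1}\succ_t t^{d_2}$. Let $G$ be a finite Gröbner basis, with respect to $\succ$, of the ideal generated by $\mathscr P(t,x)$ in $\mathbb C[t,x]$. Let $\mathrm{Bad}(t)\subseteq\mathbb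 C[t]$ be the set of non-zero polynomials in $t$ that appear as coefficients of some $g\in G$, regarded as a polynomial in $x$ with coefficients in $\mathbb C[t]$, and let $Z(t)=\bigcup_{h\in\mathrm{Bad}(t)}\{a\in\mathbb C^m: h(a)=0\}$. Assume: 1. There is a Zariski closed proper subset $E\subsetneq\mathbb C^m$ such that for all $a\in\mathbb C^m\setminus E$ the system $\mathscr P(a,x)$ has at least $\ell$ solutions in $\mathbb C^n$, counted with multiplicity (this holds in particular if it has at least $\ell$ distinct solutions). 2. There is $a'\in\mathbb C^m\setminus Z(t)$ such that $\mathscr P(a',x)$ has exactly $\ell$ solutions in $\mathbb C^n$, counted with multiplicity. Let $K\subseteq\mathbb R^m\subseteq\mathbb C^m$ be a subset of positive (or infinite) Lebesgue measure $\lambda_m$. Then there is a set $N\subseteq\mathbb R^m$ with $\lambda_m(N)=0$ such that for every $a\in K\setminus N$ the system $\mathscr P(a,x)$ has exactly $\ell$ solutions in $\mathbb C^n$, counted with multiplicity. -/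

import Mathlib

open MvPolynomial

noncomputable section

namespace ParamSystem

/-- Block order on monomials in `(x, t)` (variables `x` indexed by `σ`, `t` by `τ`) with `x ≻ t`:
compare the `x`-parts first with `ordX`, and break ties by comparing the `t`-parts with `ordT`. -/
def blockOrder {σ τ : Type*} (ordX : MonomialOrder σ) (ordT : MonomialOrder τ) :
    MonomialOrder (σ ⊕ τ) where
  syn := Lex (ordX.syn × ordT.syn)
  toSyn := (Finsupp.sumFinsuppAddEquivProdFinsupp.trans
    (ordX.toSyn.prodCongr ordT.toSyn)).trans
      { toEquiv := toLex, map_add' := fun _ _ => rfl }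
  toSyn_monotone := by
    intro a b hab
    refine Prod.Lex.toLex_mono ?_
    exact ⟨ordX.toSyn_monotone fun i => hab (Sum.inl i),
      ordT.toSyn_monotone fun i => hab (Sum.inr i)⟩

/-- The block order satisfies the defining equivalence. -/
theorem blockOrder_lt_iff {σ τ : Type*} (ordX : MonomialOrder σ) (ordT : MonomialOrder τ)
    (e₁ e₂ : σ →₀ ℕ) (d₁ d₂ : τ →₀ ℕ) :
    (blockOrder ordX ordT).toSyn (Finsupp.sumElim e₂ d₂) <
        (blockOrder ordX ordT).toSyn (Finsupp.sumElim e₁ d₁) ↔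
      ordX.toSyn e₂ < ordX.toSyn e₁ ∨ (e₁ = e₂ ∧ ordT.toSyn d₂ < ordT.toSyn d₁) := by
  have key : ∀ (e : σ →₀ ℕ) (d : τ →₀ ℕ), (blockOrder ordX ordT).toSyn (Finsupp.sumElim e d) =
      toLex (ordX.toSyn e, ordT.toSyn d) := by
    intro e d
    change toLex (ordX.toSyn _, ordT.toSyn _) = _
    congr 3
    · ext i; rfl
    · ext i; rfl
  rw [key, key]
  refine (Prod.Lex.toLex_lt_toLex).trans ?_
  simp [eq_comm]

/-- `G` is a (finite) Gröbner basis of the ideal `I` with respect to the monomial order `ord`: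
`G ⊆ I` and the leading terms of `G` generate the ideal generated by the leading terms of `I`. -/
def IsGroebnerBasis {σ : Type*} (ord : MonomialOrder σ) (G : Finset (MvPolynomial σ ℂ))
    (I : Ideal (MvPolynomial σ ℂ)) : Prop :=
  (G : Set (MvPolynomial σ ℂ)) ⊆ I ∧
    Ideal.span (ord.leadingTerm '' (G : Set (MvPolynomial σ ℂ))) =
      Ideal.span (ord.leadingTerm '' (I : Set (MvPolynomial σ ℂ)))

/-- `Bad(t)`: the nonzero polynomials in `t` appearing as coefficients of some `g ∈ G`, where
`g ∈ ℂ[x, t]` is regarded as a polynomial in `x` with coefficients in `ℂ[t]`. -/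
def badCoeffs {n m : ℕ} (G : Finset (MvPolynomial (Fin n ⊕ Fin m) ℂ)) :
    Set (MvPolynomial (Fin m) ℂ) :=
  {h | h ≠ 0 ∧ ∃ g ∈ G, ∃ e : Fin n →₀ ℕ, h = coeff e (sumAlgEquiv ℂ (Fin n) (Fin m) g)}

/-- `Z(t)`: the union of the zero sets of the polynomials in `Bad(t)`. -/
def badSet {n m : ℕ} (G : Finset (MvPolynomial (Fin n ⊕ Fin m) ℂ)) : Set (Fin m → ℂ) :=
  ⋃ h ∈ badCoeffs G, {a | eval a h = 0}

/-- `E ⊆ ℂ^m` is Zariski closed: it is the zero locus of an ideal. -/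
def IsZariskiClosed {m : ℕ} (E : Set (Fin m → ℂ)) : Prop :=
  ∃ J : Ideal (MvPolynomial (Fin m) ℂ), E = zeroLocus ℂ J

/-- The substitution `t ↦ a`, `x ↦ x`, from `ℂ[x, t]` to `ℂ[x]`. -/
def specialize {n m : ℕ} (a : Fin m → ℂ) :
    MvPolynomial (Fin n ⊕ Fin m) ℂ →ₐ[ℂ] MvPolynomial (Fin n) ℂ :=
  aeval (Sum.elim X fun j => C (a j))

/-- The local ring of `ℂ^n` at the point `p`. -/
abbrev LocalRingAt {n : ℕ} (p : Fin n → ℂ) : Type :=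
  Localization.AtPrime (vanishingIdeal ℂ {p} : Ideal (MvPolynomial (Fin n) ℂ))

/-- The multiplicity of the point `p` as a solution of the system `S ⊆ ℂ[x]`: the dimension over
`ℂ` of `O_p / S O_p`, where `O_p` is the local ring of `ℂ^n` at `p`. -/
def multiplicityAt {n : ℕ} (S : Set (MvPolynomial (Fin n) ℂ)) (p : Fin n → ℂ) : ℕ∞ :=
  Cardinal.toENat (Module.rank ℂ
    (LocalRingAt p ⧸ Ideal.span (algebraMap (MvPolynomial (Fin n) ℂ) (LocalRingAt p) '' S)))

/-- The solutions in `ℂ^n` of the system `S`. -/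
def solutions {n : ℕ} (S : Set (MvPolynomial (Fin n) ℂ)) : Set (Fin n → ℂ) :=
  {p | ∀ f ∈ S, eval p f = 0}

/-- The number, in `{0, 1, 2, …, ∞}`, of solutions of `S` in `ℂ^n` counted with multiplicity: the
sum over all solutions of their multiplicities, as the supremum of its finite partial sums. -/
def solutionCount {n : ℕ} (S : Set (MvPolynomial (Fin n) ℂ)) : ℕ∞ :=
  ⨆ s : Finset (solutions S), ∑ p ∈ s, multiplicityAt S p

/-- Off a proper Zariski closed set of parameters, the system has at least `ℓ` solutions, counted
with multiplicity. -/
def GenericallyAtLeast {n m : ℕ} (P : Set (MvPolynomial (Fin n ⊕ Fin m) ℂ)) (ℓ : ℕ) : Prop :=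
  ∃ E : Set (Fin m → ℂ), IsZariskiClosed E ∧ E ≠ Set.univ ∧
    ∀ a, a ∉ E → (ℓ : ℕ∞) ≤ solutionCount (specialize a '' P)

/-- At some parameter outside the bad set of `G`, the system has exactly `ℓ` solutions, counted
with multiplicity. -/
def ExactlyAtGoodParameter {n m : ℕ} (P : Set (MvPolynomial (Fin n ⊕ Fin m) ℂ))
    (G : Finset (MvPolynomial (Fin n ⊕ Fin m) ℂ)) (ℓ : ℕ) : Prop :=
  ∃ a, a ∉ badSet G ∧ solutionCount (specialize a '' P) = ℓ

end ParamSystem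

end

/-!
The number of solutions, counted with multiplicity, is the same at every parameter outside the bad
set, and the bad set meets the real parameters in a null set.

Write `I` for the ideal generated by the system and `R = ℂ[t]`. As the block order compares the
`x`-parts first, the leading exponent over `R` of a polynomial is the `x`-part of its leading
exponent. Hence every nonzero element of `I`, seen in `R[x]`, has leading exponent divisible by
that of a nonzero `g ∈ G`, so `I` contains no nonzero combination of standard monomials, those
divisible by no such exponent. If `a` lies outside the bad set, the leading coefficients over `R`
of the nonzero elements of `G` do not vanish at `a`; they can be inverted there, and division by
`G` reduces every polynomial to a combination of standard monomials
(`reducibleTo_standard_eq_top`). In other words, near `a` the quotient `R[x] / I` is free over `R`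
on the standard monomials, and this survives the base change `t ↦ a`
(`isCompl_restrictSupport_map`). So the dimension of `ℂ[x] / I_a`, where `I_a` is the ideal
generated by the specialized system, is the number of standard monomials, for all such `a`
(`rank_quotient_specialize`).

That dimension is the number of solutions counted with multiplicity (`solutionCount_eq_rank`): if
the solutions are finite in number, the Nullstellensatz shows that the coordinate ring has
dimension zero, and it is then the product of its localizations; otherwise both numbers are
infinite.

Finally the bad set is a finite union of zero sets of nonzero polynomials, each of which meets
`ℝ^m` in a null set by Fubini's theorem (`volume_real_zeros_eq_zero`).
-/

namespace ParamSystem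

/-! ### Reduction modulo an ideal up to denominators -/

section Reduction

variable {σ R : Type*} [CommRing R]

/-- The polynomials `f` that are congruent modulo `I`, after multiplication by some scalar in the
multiplicative set `M`, to an element of `S`: those whose image over the localization at `M` lies
in the span of `S` modulo `I`, expressed without denominators. -/
def reducibleTo (M : Submonoid R) (I : Ideal (MvPolynomial σ R))
    (S : Submodule R (MvPolynomial σ R)) : Submodule R (MvPolynomial σ R) where
  carrier := {f | ∃ s ∈ M, ∃ r ∈ S, s • f - r ∈ I}
  zero_mem' := ⟨1, M.one_mem, 0, S.zero_mem, by simp⟩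
  add_mem' := by
    rintro f g ⟨s, hs, r, hr, h⟩ ⟨s', hs', r', hr', h'⟩
    refine ⟨s * s', M.mul_mem hs hs', s' • r + s • r',
      S.add_mem (S.smul_mem _ hr) (S.smul_mem _ hr'), ?_⟩
    have h₁ := I.add_mem (Submodule.smul_of_tower_mem I s' h) (Submodule.smul_of_tower_mem I s h')
    convert h₁ using 1
    module
  smul_mem' := by
    rintro c f ⟨s, hs, r, hr, h⟩
    refine ⟨s, hs, c • r, S.smul_mem _ hr, ?_⟩
    convert Submodule.smul_of_tower_mem I c h using 1
    module

variable {M : Submonoid R} {I : Ideal (MvPolynomial σ R)} {S : Submodule R (MvPolynomial σ R)}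

theorem le_reducibleTo : S ≤ reducibleTo M I S :=
  fun f hf => ⟨1, M.one_mem, f, hf, by simp⟩

theorem mem_reducibleTo_of_mem_ideal {f : MvPolynomial σ R} (hf : f ∈ I) :
    f ∈ reducibleTo M I S :=
  ⟨1, M.one_mem, 0, S.zero_mem, by simpa using hf⟩

theorem mem_reducibleTo_of_smul_mem {f : MvPolynomial σ R} {s : R} (hs : s ∈ M)
    (hf : s • f ∈ reducibleTo M I S) : f ∈ reducibleTo M I S := by
  obtain ⟨s', hs', r, hr, h⟩ := hf
  exact ⟨s' * s, M.mul_mem hs' hs, r, hr, by rwa [mul_smul]⟩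

/-- Division by elements of `I` whose leading coefficients become units at `M` reduces every
polynomial to a combination of standard monomials. -/
theorem reducibleTo_standard_eq_top (ord : MonomialOrder σ) {G : Set (MvPolynomial σ R)}
    (hGI : G ⊆ I) (hlc : ∀ g ∈ G, ord.leadingCoeff g ∈ M) :
    reducibleTo M I (restrictSupport R {e | ∀ g ∈ G, ¬ ord.degree g ≤ e}) = ⊤ := by
  set N := reducibleTo M I (restrictSupport R {e | ∀ g ∈ G, ¬ ord.degree g ≤ e})
  have of_monomials : ∀ f : MvPolynomial σ R, (∀ e ∈ f.support, monomial e (1 : R) ∈ N) →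
      f ∈ N := by
    intro f hf
    rw [f.as_sum]
    refine N.sum_mem fun e he => ?_
    have := N.smul_mem (coeff e f) (hf e he)
    rwa [smul_monomial, smul_eq_mul, mul_one] at this
  have key : ∀ e : σ →₀ ℕ, monomial e (1 : R) ∈ N := by
    intro e
    induction e using (InvImage.wf ord.toSyn (wellFounded_lt (α := ord.syn))).induction with
    | _ e ih =>
      by_cases he : ∀ g ∈ G, ¬ ord.degree g ≤ e
      · apply le_reducibleTo
        exact (monomial_mem_restrictSupport _).2 (.inl he)
      · push Not at he
        obtain ⟨g, hg, hge⟩ := he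
        have hmulI : monomial (e - ord.degree g) (1 : R) * g ∈ I := I.mul_mem_left _ (hGI hg)
        refine mem_reducibleTo_of_smul_mem (hlc g hg) ?_
        have hsplit : ord.leadingCoeff g • monomial e (1 : R) =
            monomial (e - ord.degree g) (1 : R) * g -
            (monomial (e - ord.degree g) (1 : R) * g -
              ord.leadingCoeff g • monomial e (1 : R)) := by ring
        rw [hsplit]
        refine N.sub_mem (mem_reducibleTo_of_mem_ideal hmulI) (of_monomials _ fun d hd => ih d ?_)
        classical
        -- the coefficient at `e` cancels, and all other monomials are smaller
        have hne : d ≠ e := by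
          rintro rfl
          rw [mem_support_iff] at hd
          apply hd
          simp [coeff_monomial_mul', MonomialOrder.leadingCoeff, tsub_tsub_cancel_of_le hge]
        rw [mem_support_iff, coeff_sub, coeff_smul, coeff_monomial, if_neg hne.symm, smul_zero,
          sub_zero, coeff_monomial_mul', one_mul] at hd
        have hle : e - ord.degree g ≤ d := by
          by_contra h; simp [h] at hd
        rw [if_pos hle] at hd
        have h₁ : ord.toSyn (d - (e - ord.degree g)) ≤ ord.toSyn (ord.degree g) :=
          ord.le_degree (mem_support_iff.2 hd)
        have h₂ := add_le_add_right h₁ (ord.toSyn (e - ord.degree g))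
        rw [← map_add, ← map_add, tsub_add_cancel_of_le hge, add_tsub_cancel_of_le hle] at h₂
        exact lt_of_le_of_ne h₂ fun h => hne (ord.toSyn.injective h)
  exact eq_top_iff.2 fun f _ => of_monomials f fun e _ => key e

/-- If `R[x] / I` is free on the monomials in `B` up to denominators that survive under a
surjection `φ : R → k` onto a field, then `B` is a monomial basis of the fibre over `φ`. -/
theorem isCompl_restrictSupport_map {k : Type*} [Field k] (φ : R →+* k)
    (hφ : Function.Surjective φ) (B : Set (σ →₀ ℕ))
    (hred : reducibleTo ((nonZeroDivisors k).comap φ) I (restrictSupport R B) = ⊤)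
    (huniq : ∀ r ∈ restrictSupport R B, r ∈ I → r = 0) :
    IsCompl (restrictSupport k B) ((I.map (MvPolynomial.map φ)).restrictScalars k) := by
  have hsurj := MvPolynomial.map_surjective (σ := σ) φ hφ
  have map_mem : ∀ r ∈ restrictSupport R B, MvPolynomial.map φ r ∈ restrictSupport k B := by
    intro r hr
    rw [mem_restrictSupport_iff] at hr ⊢
    exact fun d hd => hr (support_map_subset φ r hd)
  constructor
  · rw [Submodule.disjoint_def]
    intro f hfB hfI
    obtain ⟨F, hF, rfl⟩ := (Ideal.mem_map_iff_of_surjective _ hsurj).1 hfI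
    -- a lift of `f` supported on `B`
    obtain ⟨F₀, hF₀, hF₀f⟩ : ∃ F₀ ∈ restrictSupport R B,
        MvPolynomial.map φ F₀ = MvPolynomial.map φ F := by
      refine ⟨∑ d ∈ (MvPolynomial.map φ F).support, monomial d (coeff d F), ?_, ?_⟩
      · refine Submodule.sum_mem _ fun d hd => ?_
        exact (monomial_mem_restrictSupport _).2 (.inl ((mem_restrictSupport_iff _).1 hfB hd))
      · conv_rhs => rw [(MvPolynomial.map φ F).as_sum]
        simp [coeff_map]
    -- modulo `I`, the difference reduces to an element with coefficients in the kernel of `φ`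
    let T : Submodule R (MvPolynomial σ R) := restrictSupport R B ⊓
      ((RingHom.ker (MvPolynomial.map (σ := σ) φ)).restrictScalars R)
    have hdiff : F₀ - F ∈ reducibleTo ((nonZeroDivisors k).comap φ) I T := by
      rw [(F₀ - F).as_sum]
      refine Submodule.sum_mem _ fun d _ => ?_
      have hc : φ (coeff d (F₀ - F)) = 0 := by
        rw [← coeff_map, map_sub, hF₀f, sub_self, coeff_zero]
      obtain ⟨s, hs, r, hr, h⟩ : monomial d (1 : R) ∈
        reducibleTo ((nonZeroDivisors k).comap φ) I (restrictSupport R B) := hred ▸ trivial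
      refine ⟨s, hs, coeff d (F₀ - F) • r, ⟨Submodule.smul_mem _ _ hr, ?_⟩, ?_⟩
      · change MvPolynomial.map φ _ = 0
        rw [smul_eq_C_mul, map_mul, map_C, hc, C_0, zero_mul]
      · have := Submodule.smul_of_tower_mem I (coeff d (F₀ - F)) h
        rw [smul_sub, smul_comm, smul_monomial, smul_eq_mul, mul_one] at this
        exact this
    obtain ⟨s, hs, r, ⟨hr, hr0⟩, h⟩ := hdiff
    have hzero : s • F₀ - r = 0 := by
      refine huniq _ (Submodule.sub_mem _ (Submodule.smul_mem _ _ hF₀) hr) ?_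
      convert I.add_mem h (Submodule.smul_of_tower_mem I s hF) using 1
      rw [smul_sub]; ring
    have h' := congrArg (MvPolynomial.map φ) hzero
    have hr0 : MvPolynomial.map φ r = 0 := hr0
    rw [map_sub, hr0, sub_zero, smul_eq_C_mul, map_mul, map_C, map_zero, hF₀f] at h'
    have hs' : φ s ≠ 0 := nonZeroDivisors.ne_zero hs
    exact (mul_eq_zero.1 h').resolve_left (by simpa using hs')
  · rw [codisjoint_iff, eq_top_iff]
    intro f _
    obtain ⟨F, rfl⟩ := hsurj f
    obtain ⟨s, hs, r, hr, h⟩ : F ∈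
      reducibleTo ((nonZeroDivisors k).comap φ) I (restrictSupport R B) := hred ▸ trivial
    have hs' : φ s ≠ 0 := nonZeroDivisors.ne_zero hs
    have h₁ := Ideal.mem_map_of_mem (MvPolynomial.map φ) h
    rw [map_sub, smul_eq_C_mul, map_mul, map_C, ← smul_eq_C_mul] at h₁
    rw [← inv_smul_smul₀ hs' (MvPolynomial.map φ F)]
    refine Submodule.smul_mem _ _ ?_
    rw [← add_sub_cancel (MvPolynomial.map φ r) (φ s • MvPolynomial.map φ F)]
    exact Submodule.add_mem_sup (map_mem r hr) h₁

end Reduction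

/-! ### Standard monomials of the fibres -/

section Fibres

theorem blockOrder_toSyn {σ τ : Type*} (ordX : MonomialOrder σ) (ordT : MonomialOrder τ)
    (e : σ ⊕ τ →₀ ℕ) : (blockOrder ordX ordT).toSyn e =
      toLex (ordX.toSyn (Finsupp.sumFinsuppAddEquivProdFinsupp e).1,
        ordT.toSyn (Finsupp.sumFinsuppAddEquivProdFinsupp e).2) := rfl

theorem coeff_coeff_sumAlgEquiv {σ τ : Type*} (f : MvPolynomial (σ ⊕ τ) ℂ) (e : σ ⊕ τ →₀ ℕ) :
    coeff (Finsupp.sumFinsuppAddEquivProdFinsupp e).2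
      (coeff (Finsupp.sumFinsuppAddEquivProdFinsupp e).1 (sumAlgEquiv ℂ σ τ f)) = coeff e f := by
  classical
  induction f using MvPolynomial.induction_on' with
  | monomial u c =>
    have h : sumAlgEquiv ℂ σ τ (monomial u c) =
        monomial (Finsupp.sumFinsuppAddEquivProdFinsupp u).1
          (monomial (Finsupp.sumFinsuppAddEquivProdFinsupp u).2 c) := by
      simp [sumAlgEquiv, monomial]
    have hu : u = e ↔ (Finsupp.sumFinsuppAddEquivProdFinsupp u).1 =
          (Finsupp.sumFinsuppAddEquivProdFinsupp e).1 ∧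
        (Finsupp.sumFinsuppAddEquivProdFinsupp u).2 =
          (Finsupp.sumFinsuppAddEquivProdFinsupp e).2 := by
      rw [← Prod.ext_iff, EmbeddingLike.apply_eq_iff_eq]
    rw [h, coeff_monomial, coeff_monomial]
    split_ifs with h₁ h₂ h₂
    · rw [coeff_monomial, if_pos (hu.1 h₂).2]
    · rw [coeff_monomial, if_neg fun h₃ => h₂ (hu.2 ⟨h₁, h₃⟩)]
    · exact absurd (hu.1 h₂).1 h₁
    · rw [coeff_zero]
  | add p q hp hq => rw [map_add, coeff_add, coeff_add, coeff_add, hp, hq]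

/-- The block order sees the `x`-part first, so the leading exponent over `ℂ[t]` is the `x`-part of
the leading exponent. -/
theorem degree_sumAlgEquiv {σ τ : Type*} (ordX : MonomialOrder σ) (ordT : MonomialOrder τ)
    {f : MvPolynomial (σ ⊕ τ) ℂ} (hf : f ≠ 0) :
    ordX.degree (sumAlgEquiv ℂ σ τ f) =
      (Finsupp.sumFinsuppAddEquivProdFinsupp ((blockOrder ordX ordT).degree f)).1 := by
  have hF : sumAlgEquiv ℂ σ τ f ≠ 0 := by simpa using hf
  apply ordX.toSyn.injective
  apply le_antisymm
  · obtain ⟨d, hd⟩ := ne_zero_iff.1 (mem_support_iff.1 (ordX.degree_mem_support hF))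
    have hc := coeff_coeff_sumAlgEquiv f (Finsupp.sumFinsuppAddEquivProdFinsupp.symm
      (ordX.degree (sumAlgEquiv ℂ σ τ f), d))
    rw [AddEquiv.apply_symm_apply] at hc
    have hle := (blockOrder ordX ordT).le_degree (mem_support_iff.2 (hc ▸ hd))
    rw [blockOrder_toSyn, blockOrder_toSyn, AddEquiv.apply_symm_apply] at hle
    exact Prod.Lex.monotone_fst _ _ hle
  · refine ordX.le_degree (mem_support_iff.2 fun h => ?_)
    have hc := coeff_coeff_sumAlgEquiv f ((blockOrder ordX ordT).degree f)
    rw [h, coeff_zero] at hc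
    exact (blockOrder ordX ordT).coeff_degree_ne_zero_iff.2 hf hc.symm

theorem IsGroebnerBasis.exists_degree_le {σ : Type*} {ord : MonomialOrder σ}
    {G : Finset (MvPolynomial σ ℂ)} {I : Ideal (MvPolynomial σ ℂ)} (hG : IsGroebnerBasis ord G I)
    {f : MvPolynomial σ ℂ} (hf : f ∈ I) (hf0 : f ≠ 0) :
    ∃ g ∈ G, g ≠ 0 ∧ ord.degree g ≤ ord.degree f := by
  have hmem : ord.leadingTerm f ∈ Ideal.span (ord.leadingTerm '' (G : Set (MvPolynomial σ ℂ))) :=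
    hG.2 ▸ Ideal.subset_span ⟨f, hf, rfl⟩
  have hle : Ideal.span (ord.leadingTerm '' (G : Set (MvPolynomial σ ℂ))) ≤
      Ideal.span ((fun s => monomial s (1 : ℂ)) '' {d | ∃ g ∈ G, g ≠ 0 ∧ ord.degree g = d}) := by
    rw [Ideal.span_le]
    rintro _ ⟨g, hg, rfl⟩
    by_cases h0 : g = 0
    · simp [h0]
    · rw [MonomialOrder.leadingTerm, ← mul_one (ord.leadingCoeff g), ← smul_eq_mul, ← smul_monomial]
      exact Submodule.smul_of_tower_mem _ _ (Ideal.subset_span ⟨_, ⟨g, hg, h0, rfl⟩, rfl⟩)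
  classical
  obtain ⟨_, ⟨g, hg, hg0, rfl⟩, hd⟩ := mem_ideal_span_monomial_image.1 (hle hmem) (ord.degree f) (by
    rw [mem_support_iff, MonomialOrder.leadingTerm, coeff_monomial, if_pos rfl]
    exact ord.leadingCoeff_ne_zero_iff.2 hf0)
  exact ⟨g, hg, hg0, hd⟩

variable {n m : ℕ}

theorem specialize_eq_map_eval (a : Fin m → ℂ) (f : MvPolynomial (Fin n ⊕ Fin m) ℂ) :
    specialize a f = MvPolynomial.map (eval a) (sumAlgEquiv ℂ (Fin n) (Fin m) f) := by
  have : (specialize (n := n) a).toRingHom = (MvPolynomial.map (eval a)).comp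
      (sumAlgEquiv ℂ (Fin n) (Fin m)).toAlgHom.toRingHom := by
    refine ringHom_ext (fun c => ?_) (Sum.rec (fun i => ?_) fun j => ?_) <;> simp [specialize]
  exact RingHom.congr_fun this f

/-- The exponents in `x` not divisible by the leading exponent over `ℂ[t]` of a nonzero `g ∈ G`. -/
def standardExponents (ordX : MonomialOrder (Fin n))
    (G : Finset (MvPolynomial (Fin n ⊕ Fin m) ℂ)) : Set (Fin n →₀ ℕ) :=
  {e | ∀ g ∈ sumAlgEquiv ℂ (Fin n) (Fin m) '' {g | g ∈ G ∧ g ≠ 0}, ¬ ordX.degree g ≤ e}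

/-- Off the bad set, the standard monomials form a basis of the coordinate ring of the fibre, so
its dimension does not depend on the parameter. -/
theorem rank_quotient_specialize {ordX : MonomialOrder (Fin n)} {ordT : MonomialOrder (Fin m)}
    {P : Set (MvPolynomial (Fin n ⊕ Fin m) ℂ)} {G : Finset (MvPolynomial (Fin n ⊕ Fin m) ℂ)}
    (hG : IsGroebnerBasis (blockOrder ordX ordT) G (Ideal.span P))
    {a : Fin m → ℂ} (ha : a ∉ badSet G) :
    Module.rank ℂ (MvPolynomial (Fin n) ℂ ⧸ Ideal.span (specialize a '' P)) =
      Cardinal.mk (standardExponents ordX G) := by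
  let ψ := sumAlgEquiv ℂ (Fin n) (Fin m)
  let I : Ideal (MvPolynomial (Fin n) (MvPolynomial (Fin m) ℂ)) :=
    (Ideal.span P).map ψ.toAlgHom.toRingHom
  have mem_I : ∀ {f}, ψ f ∈ I ↔ f ∈ Ideal.span P := fun {f} => by
    constructor
    · intro h
      obtain ⟨f', hf', h'⟩ := (Ideal.mem_map_iff_of_surjective _ ψ.surjective).1 h
      have h'' : f' = f := ψ.injective h'
      rwa [← h'']
    · exact Ideal.mem_map_of_mem ψ.toAlgHom.toRingHom
  have hI : I.map (MvPolynomial.map (eval a)) = Ideal.span (specialize a '' P) := by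
    rw [Ideal.map_map, Ideal.map_span]
    congr 1
    exact Set.image_congr fun f _ => (specialize_eq_map_eval a f).symm
  have hcompl := isCompl_restrictSupport_map (I := I) (eval a) (fun c => ⟨C c, eval_C c⟩)
    (standardExponents ordX G) (by
      refine reducibleTo_standard_eq_top ordX ?_ ?_
      · rintro _ ⟨g, ⟨hg, -⟩, rfl⟩
        exact mem_I.2 (hG.1 hg)
      · rintro _ ⟨g, ⟨hg, hg0⟩, rfl⟩
        rw [Submonoid.mem_comap, mem_nonZeroDivisors_iff_ne_zero]
        intro h0
        refine ha (Set.mem_iUnion₂.2 ⟨ordX.leadingCoeff (ψ g), ⟨?_, g, hg, _, rfl⟩, h0⟩)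
        exact ordX.leadingCoeff_ne_zero_iff.2 (by simpa using hg0))
    (by
      intro r hr hrI
      by_contra hr0
      obtain ⟨f, rfl⟩ := ψ.surjective r
      have hf0 : f ≠ 0 := fun h => hr0 (by simp [h])
      obtain ⟨g, hg, hg0, hle⟩ := hG.exists_degree_le (mem_I.1 hrI) hf0
      refine (mem_restrictSupport_iff _).1 hr (ordX.degree_mem_support hr0) _ ⟨g, ⟨hg, hg0⟩, rfl⟩ ?_
      rw [degree_sumAlgEquiv ordX ordT hg0, degree_sumAlgEquiv ordX ordT hf0]
      exact fun i => hle (Sum.inl i))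
  rw [← hI]
  exact ((Submodule.quotientEquivOfIsCompl _ _ hcompl.symm).rank_eq).trans
    (basisRestrictSupport ℂ _).mk_eq_rank''.symm

end Fibres

/-! ### Counting solutions by the dimension of the coordinate ring -/

section Count

variable {n : ℕ} {S : Set (MvPolynomial (Fin n) ℂ)}

theorem eval_eq_zero_of_mem_span (p : solutions S) {f : MvPolynomial (Fin n) ℂ}
    (hf : f ∈ Ideal.span S) : eval p.1 f = 0 :=
  (Ideal.span_le (I := RingHom.ker (eval p.1))).2 p.2 hf

theorem span_le_vanishingIdeal_iff {p : Fin n → ℂ} :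
    Ideal.span S ≤ vanishingIdeal ℂ {p} ↔ p ∈ solutions S := by
  rw [Ideal.span_le]
  refine forall₂_congr fun f _ => ?_
  rw [SetLike.mem_coe, mem_vanishingIdeal_singleton_iff, aeval_eq_eval]

theorem multiplicityAt_ne_zero {p : Fin n → ℂ} (hp : p ∈ solutions S) :
    multiplicityAt S p ≠ 0 := by
  rw [multiplicityAt, Ne, Cardinal.toENat_eq_zero, ← Ideal.map_span]
  have hne : (Ideal.span S).map (algebraMap _ (LocalRingAt p)) ≠ ⊤ := by
    refine ne_top_of_le_ne_top (IsLocalRing.maximalIdeal.isMaximal (LocalRingAt p)).ne_top ?_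
    rw [← Localization.AtPrime.map_eq_maximalIdeal]
    exact Ideal.map_mono (span_le_vanishingIdeal_iff.2 hp)
  have := Ideal.Quotient.nontrivial_iff.2 hne
  exact rank_pos.ne'

/-- The prime of the coordinate ring of the system corresponding to a solution. -/
noncomputable def primeOfSolution (p : solutions S) :
    PrimeSpectrum (MvPolynomial (Fin n) ℂ ⧸ Ideal.span S) :=
  ⟨RingHom.ker (Ideal.Quotient.lift (Ideal.span S) (eval p.1)
    fun _ hf => eval_eq_zero_of_mem_span p hf), RingHom.ker_isPrime _⟩

theorem mk_mem_primeOfSolution {p : solutions S} {f : MvPolynomial (Fin n) ℂ} :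
    Ideal.Quotient.mk (Ideal.span S) f ∈ (primeOfSolution p).asIdeal ↔
      f ∈ vanishingIdeal ℂ {p.1} := by
  rw [mem_vanishingIdeal_singleton_iff, aeval_eq_eval]
  rfl

theorem primeOfSolution_injective : Function.Injective (primeOfSolution (S := S)) := by
  intro p q h
  ext i
  have hp : Ideal.Quotient.mk (Ideal.span S) (X i - C (p.1 i)) ∈ (primeOfSolution p).asIdeal :=
    mk_mem_primeOfSolution.2 (by simp)
  rw [h, mk_mem_primeOfSolution] at hp
  exact (by simpa [sub_eq_zero] using hp : q.1 i = p.1 i).symm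

theorem primeOfSolution_surjective
    [Ring.KrullDimLE 0 (MvPolynomial (Fin n) ℂ ⧸ Ideal.span S)] :
    Function.Surjective (primeOfSolution (S := S)) := by
  intro P
  have : P.asIdeal.IsMaximal := inferInstance
  have hmax : (P.asIdeal.comap (Ideal.Quotient.mk (Ideal.span S))).IsMaximal :=
    Ideal.comap_isMaximal_of_surjective _ Ideal.Quotient.mk_surjective
  obtain ⟨x, hx⟩ := isMaximal_iff_eq_vanishingIdeal_singleton.1 hmax
  have hle : Ideal.span S ≤ vanishingIdeal ℂ {x} := by
    rw [← hx, ← Ideal.map_le_iff_le_comap, Ideal.map_quotient_self]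
    exact bot_le
  refine ⟨⟨x, span_le_vanishingIdeal_iff.1 hle⟩, PrimeSpectrum.ext (Ideal.ext fun y => ?_)⟩
  obtain ⟨f, rfl⟩ := Ideal.Quotient.mk_surjective y
  rw [mk_mem_primeOfSolution, ← hx, Ideal.mem_comap]

/-- Localization commutes with the quotient: the multiplicity is computed in the local ring of the
coordinate ring. -/
theorem multiplicityAt_eq_rank_localization (p : solutions S) :
    multiplicityAt S p.1 =
      Cardinal.toENat (Module.rank ℂ (Localization.AtPrime (primeOfSolution p).asIdeal)) := by
  have hM : Algebra.algebraMapSubmonoid (MvPolynomial (Fin n) ℂ ⧸ Ideal.span S)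
      (vanishingIdeal ℂ {p.1}).primeCompl = (primeOfSolution p).asIdeal.primeCompl := by
    ext y
    constructor
    · rintro ⟨f, hf, rfl⟩
      exact fun h => hf (mk_mem_primeOfSolution.1 h)
    · intro hy
      obtain ⟨f, rfl⟩ := Ideal.Quotient.mk_surjective y
      exact ⟨f, fun h => hy (mk_mem_primeOfSolution.2 h), rfl⟩
  have hloc : IsLocalization (primeOfSolution p).asIdeal.primeCompl
      (LocalRingAt p.1 ⧸ (Ideal.span S).map (algebraMap _ (LocalRingAt p.1))) := by
    rw [← hM]; infer_instance
  have htower : IsScalarTower ℂ (MvPolynomial (Fin n) ℂ ⧸ Ideal.span S)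
      (LocalRingAt p.1 ⧸ (Ideal.span S).map (algebraMap _ (LocalRingAt p.1))) :=
    ⟨fun c q z => by
      obtain ⟨f, rfl⟩ := Ideal.Quotient.mk_surjective q
      obtain ⟨o, rfl⟩ := Ideal.Quotient.mk_surjective z
      exact congrArg (Ideal.Quotient.mk
        ((Ideal.span S).map (algebraMap _ (LocalRingAt p.1)))) (smul_assoc c f o)⟩
  rw [multiplicityAt, ← Ideal.map_span]
  congr 1
  exact (((IsLocalization.algEquiv (primeOfSolution p).asIdeal.primeCompl
    (LocalRingAt p.1 ⧸ (Ideal.span S).map (algebraMap _ (LocalRingAt p.1)))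
    (Localization.AtPrime (primeOfSolution p).asIdeal)).restrictScalars ℂ).toLinearEquiv).rank_eq

theorem krullDimLE_zero_of_finite_solutions (hfin : (solutions S).Finite) :
    Ring.KrullDimLE 0 (MvPolynomial (Fin n) ℂ ⧸ Ideal.span S) := by
  rw [Ring.krullDimLE_zero_iff]
  intro P hP
  set P' := P.comap (Ideal.Quotient.mk (Ideal.span S)) with hP'
  have hle : Ideal.span S ≤ P' := by
    rw [← Ideal.map_le_iff_le_comap, Ideal.map_quotient_self]
    exact bot_le
  have hsub : zeroLocus ℂ P' ⊆ solutions S := fun x hx f hf => by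
    simpa using hx f (hle (Ideal.subset_span hf))
  have hV := hfin.subset hsub
  have hprime : P'.IsPrime := inferInstance
  -- by the Nullstellensatz, `P'` is the intersection of finitely many maximal ideals
  have hinf : hV.toFinset.inf (fun x => (vanishingIdeal ℂ {x} : Ideal (MvPolynomial (Fin n) ℂ))) ≤
      P' := by
    intro f hf
    rw [← MvPolynomial.IsPrime.vanishingIdeal_zeroLocus P' (K := ℂ)]
    intro x hx
    rw [Submodule.mem_finsetInf] at hf
    exact (mem_vanishingIdeal_singleton_iff x f).1 (hf x (hV.mem_toFinset.2 hx))
  obtain ⟨x, -, hx⟩ := (hprime.inf_le').1 hinf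
  have hmax : P'.IsMaximal :=
    (inferInstance : (vanishingIdeal ℂ {x} : Ideal _).IsMaximal).eq_of_le hprime.ne_top hx ▸
      inferInstance
  rw [← Ideal.map_comap_of_surjective _ Ideal.Quotient.mk_surjective P]
  exact (Ideal.map_eq_top_or_isMaximal_of_surjective _ Ideal.Quotient.mk_surjective
    hmax).resolve_left (by
      rw [Ideal.map_comap_of_surjective _ Ideal.Quotient.mk_surjective P]; exact hP.ne_top)

theorem solutionCount_eq_top_of_infinite (hinf : (solutions S).Infinite) :
    solutionCount S = ⊤ := by
  have := hinf.to_subtype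
  refine ENat.eq_top_iff_forall_ge.2 fun k => ?_
  obtain ⟨s, hs⟩ := Infinite.exists_subset_card_eq (solutions S) k
  refine le_trans ?_ (le_iSup _ s)
  rw [← hs, Finset.card_eq_sum_ones, Nat.cast_sum]
  exact Finset.sum_le_sum fun p _ => by
    rw [Nat.cast_one]; exact Order.one_le_iff_ne_zero.2 (multiplicityAt_ne_zero p.2)

/-- If there are finitely many solutions, the coordinate ring is Artinian, hence the product of its
localizations at the solutions; otherwise both sides are infinite. -/
theorem solutionCount_eq_rank (S : Set (MvPolynomial (Fin n) ℂ)) :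
    solutionCount S =
      Cardinal.toENat (Module.rank ℂ (MvPolynomial (Fin n) ℂ ⧸ Ideal.span S)) := by
  by_cases hfin : (solutions S).Finite
  · have hdim := krullDimLE_zero_of_finite_solutions hfin
    have hQ := (Module.finite_iff_krullDimLE_zero ℂ _).2 hdim
    have : IsArtinianRing (MvPolynomial (Fin n) ℂ ⧸ Ideal.span S) :=
      (Module.finite_iff_isArtinianRing ℂ _).1 hQ
    have := hfin.fintype
    have hbij : Function.Bijective (primeOfSolution (S := S)) :=
      ⟨primeOfSolution_injective, primeOfSolution_surjective⟩
    have := Fintype.ofBijective _ hbij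
    have hloc (p : PrimeSpectrum (MvPolynomial (Fin n) ℂ ⧸ Ideal.span S)) :
        Module.Finite ℂ (Localization.AtPrime p.asIdeal) :=
      Module.Finite.of_surjective (Algebra.algHom ℂ _ (Localization.AtPrime p.asIdeal)).toLinearMap
        (IsArtinianRing.localization_surjective p.asIdeal.primeCompl _)
    rw [← Module.finrank_eq_rank, Cardinal.toENat_nat,
      IsArtinianRing.finrank_eq_sum_primeSpectrum, Nat.cast_sum,
      ← hbij.sum_comp (fun p => (Module.finrank ℂ (Localization.AtPrime p.asIdeal) : ℕ∞))]
    have hmult : ∀ p : solutions S, multiplicityAt S p.1 =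
        Module.finrank ℂ (Localization.AtPrime (primeOfSolution p).asIdeal) := fun p => by
      rw [multiplicityAt_eq_rank_localization, ← Module.finrank_eq_rank, Cardinal.toENat_nat]
    simp only [← hmult]
    exact le_antisymm (iSup_le fun s => Finset.sum_le_univ_sum_of_nonneg fun _ => zero_le)
      (le_iSup (fun s : Finset (solutions S) => ∑ p ∈ s, multiplicityAt S p.1) Finset.univ)
  · rw [solutionCount_eq_top_of_infinite hfin, eq_comm, Cardinal.toENat_eq_top]
    by_contra! hlt
    have hQ : Module.Finite ℂ (MvPolynomial (Fin n) ℂ ⧸ Ideal.span S) :=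
      Module.rank_lt_aleph0_iff.1 hlt
    have : IsArtinianRing (MvPolynomial (Fin n) ℂ ⧸ Ideal.span S) :=
      (Module.finite_iff_isArtinianRing ℂ _).1 hQ
    exact hfin (Set.finite_coe_iff.1 (Finite.of_injective _ primeOfSolution_injective))

end Count

/-! ### Real zeros of a complex polynomial -/

open MeasureTheory in
/-- By induction on the number of variables: for almost every choice of the last variables some
coefficient in the first variable survives, and then the slice is finite. -/
theorem volume_real_zeros_eq_zero {m : ℕ} {p : MvPolynomial (Fin m) ℂ} (hp : p ≠ 0) :
    volume {a : Fin m → ℝ | eval (fun j => (a j : ℂ)) p = 0} = 0 := by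
  induction m with
  | zero =>
    convert measure_empty (μ := (volume : Measure (Fin 0 → ℝ)))
    refine Set.eq_empty_of_forall_notMem fun a ha => hp ?_
    obtain ⟨c, rfl⟩ := C_surjective (Fin 0) p
    rw [Set.mem_ofPred_eq, eval_C] at ha
    rw [ha, C_0]
  | succ m ih =>
    set q := finSuccEquiv ℂ m p with hq
    have hq0 : q ≠ 0 := by simpa [hq] using hp
    let T : Set (ℝ × (Fin m → ℝ)) :=
      {z | eval (fun j => ((Fin.cons z.1 z.2 : Fin (m + 1) → ℝ) j : ℂ)) p = 0}
    have hTclosed : IsClosed T := by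
      refine isClosed_eq ?_ continuous_const
      refine (MvPolynomial.continuous_eval p).comp (continuous_pi fun j => ?_)
      refine Complex.continuous_ofReal.comp ?_
      refine Fin.cases ?_ (fun i => ?_) j
      · simpa using continuous_fst
      · simpa [Function.comp_def] using (continuous_apply i).comp continuous_snd
    have hslice : ∀ᵐ x : Fin m → ℝ, volume ((fun y => (y, x)) ⁻¹' T) = 0 := by
      have hlead : Polynomial.leadingCoeff q ≠ 0 := Polynomial.leadingCoeff_ne_zero.2 hq0
      have hae : ∀ᵐ x : Fin m → ℝ, eval (fun j => (x j : ℂ)) q.leadingCoeff ≠ 0 := by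
        rw [ae_iff]; simpa using ih hlead
      filter_upwards [hae] with x hx
      have hqx : q.map (eval fun j => (x j : ℂ)) ≠ 0 := fun h => hx (by
        have := congrArg (Polynomial.coeff · q.natDegree) h
        simpa [Polynomial.coeff_map] using this)
      have hfin : ((fun y => (y, x)) ⁻¹' T).Finite := by
        refine ((Polynomial.finite_setOfPred_isRoot hqx).preimage
          (f := fun y : ℝ => (y : ℂ)) Complex.ofReal_injective.injOn).subset fun y hy => ?_
        change Polynomial.eval (y : ℂ) _ = 0
        have hy' : eval (fun j => ((Fin.cons y x : Fin (m + 1) → ℝ) j : ℂ)) p = 0 := hy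
        rw [hq, ← eval_eq_eval_mv_eval']
        convert hy' using 3 with j
        exact funext (Fin.cases (by simp) (by simp))
      exact hfin.measure_zero _
    have hT : volume T = 0 := by
      rw [Measure.volume_eq_prod, ← Measure.prod_swap,
        Measure.map_apply measurable_swap hTclosed.measurableSet,
        Measure.measure_prod_null (measurable_swap hTclosed.measurableSet)]
      exact hslice
    have hpres := volume_preserving_piFinSuccAbove (fun _ : Fin (m + 1) => ℝ) 0
    rw [← hpres.measure_preimage hTclosed.measurableSet.nullMeasurableSet] at hT
    convert hT using 2
    ext a
    have : (Fin.cons (a 0) (fun i => a i.succ) : Fin (m + 1) → ℝ) = a := Fin.cons_self_tail a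
    simp only [T, Set.mem_ofPred_eq, Set.mem_preimage]
    rw [show MeasurableEquiv.piFinSuccAbove (fun _ : Fin (m + 1) => ℝ) 0 a =
      (a 0, fun i => a i.succ) from rfl]
    simp only [this]

theorem badCoeffs_finite {n m : ℕ} (G : Finset (MvPolynomial (Fin n ⊕ Fin m) ℂ)) :
    (badCoeffs G).Finite := by
  refine (G.finite_toSet.biUnion fun g _ => ((sumAlgEquiv ℂ (Fin n) (Fin m) g).support.image
    fun e => coeff e (sumAlgEquiv ℂ (Fin n) (Fin m) g)).finite_toSet).subset ?_
  rintro _ ⟨h0, g, hg, e, rfl⟩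
  exact Set.mem_biUnion hg (Finset.mem_coe.2 (Finset.mem_image_of_mem _ (mem_support_iff.2 h0)))

theorem volume_real_badSet_eq_zero {n m : ℕ} (G : Finset (MvPolynomial (Fin n ⊕ Fin m) ℂ)) :
    MeasureTheory.volume {a : Fin m → ℝ | (fun j => (a j : ℂ)) ∈ badSet G} = 0 := by
  have : {a : Fin m → ℝ | (fun j => (a j : ℂ)) ∈ badSet G} =
      ⋃ h ∈ badCoeffs G, {a : Fin m → ℝ | eval (fun j => (a j : ℂ)) h = 0} := by
    ext a; simp [badSet]
  rw [this, MeasureTheory.measure_biUnion_null_iff (badCoeffs_finite G).countable]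
  exact fun h hh => volume_real_zeros_eq_zero hh.1

end ParamSystem

theorem mainTheorem4 {n m : ℕ} (ordX : MonomialOrder (Fin n)) (ordT : MonomialOrder (Fin m))
    (P : Set (MvPolynomial (Fin n ⊕ Fin m) ℂ))
    (G : Finset (MvPolynomial (Fin n ⊕ Fin m) ℂ))
    (hG : ParamSystem.IsGroebnerBasis (ParamSystem.blockOrder ordX ordT) G (Ideal.span P))
    (ℓ : ℕ)
    (hAtLeast : ParamSystem.GenericallyAtLeast P ℓ)
    (hExactly : ParamSystem.ExactlyAtGoodParameter P G ℓ)
    (K : Set (Fin m → ℝ)) (hK : 0 < MeasureTheory.volume K) :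
    ∃ N : Set (Fin m → ℝ), MeasureTheory.volume N = 0 ∧
      ∀ a ∈ K, a ∉ N →
        ParamSystem.solutionCount
          (ParamSystem.specialize (n := n) (fun j => (a j : ℂ)) '' P) = ℓ := by
  obtain ⟨a', ha', hcount⟩ := hExactly
  refine ⟨{a | (fun j => (a j : ℂ)) ∈ ParamSystem.badSet G},
    ParamSystem.volume_real_badSet_eq_zero G, fun a _ ha => ?_⟩
  rw [ParamSystem.solutionCount_eq_rank, ParamSystem.rank_quotient_specialize hG ha,
    ← ParamSystem.rank_quotient_specialize hG ha', ← ParamSystem.solutionCount_eq_rank, hcount]
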